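/- Let $A$ be a commutative ring, let $\mathbf{a} = (a_1, \ldots, a_n)$ be a finite sequence of elements of $A$, and let $\mathfrak{a} \subseteq A$ be the ideal generated by $\mathbf{a}$. For $i \geq 1$ let $\operatorname{K}(A; \mathbf{a}^i)$ be the Koszul complex of the sequence $\mathbf{a}^i = (a_1^i, \ldots, a_n^i)$, concentrated in cohomological degrees $-n, \ldots, 0$; for $j \geq i$ there is the homomorphism $\operatorname{K}(A; \mathbf{a}^j) \to \operatorname{K}(A; \mathbf{a}^i)$ of DG rings that is the identity of $A$ in degree $0$ and multiplication by the sequence $\mathbf{a}^{j-i}$ in degree $-1$. The sequence $\mathbf{a}$ is called weakly proregular if for every $p < 0$ the inverse system of $A$-modules $\{ \operatorname{H}^p(\operatorname{K}(A; \mathbf{a}^i)) \}_{i \geq 1}$ is pro-zero, i.e. for every $i$ there is some $j \geq i$ such that the homomorphism $\operatorname{H}^p(\operatorname{K}(A; \mathbf{a}^j)) \to \operatorname{H}^p(\operatorname{K}(A; \mathbf{a}^i))$ is zero. For an $A$-module $M$ let $\Gamma_{\mathfrak{a}}(M) = \{ m \in M \mid \mathfrak{a}^i m = 0 \text{ for some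 } i \geq 0 \}$, and let $\mathsf{T}_{\mathfrak{a}}$ be the class of modules $M$ such that $\Gamma_{\mathfrak{a}}(M) = M$. It is a torsion class, i.e. it is closed under submodules, quotients, extensions and arbitrary direct sums, and its torsion functor, sending $M$ to its largest submodule in $\mathsf{T}_{\mathfrak{a}}$, is $\Gamma_{\mathfrak{a}}$. The torsion class $\mathsf{T}_{\mathfrak{a}}$ is called weakly stable if for every injective $A$-module $I$ and every $q > 0$ one has $\mathrm{R}^q \Gamma_{\mathfrak{a}}(\Gamma_{\mathfrak{a}}(I)) = 0$, where $\mathrm{R}^q \Gamma_{\mathfrak{a}}$ is the $q$-th right derived functor of $\Gamma_{\mathfrak{a}}$. The following two conditions are equivalent: (i) The sequence $\mathbf{a}$ is weakly proregular. (ii) The torsion class $\mathsf{T}_{\mathfrak{a}}$ is weakly stable. -/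

import Mathlib

open CategoryTheory CategoryTheory.Limits
open scoped DirectSum

universe u

noncomputable section

namespace TorsionTheory

section Derived

variable {C D : Type*} [Category C] [Category D] [Abelian C] [Abelian D]
  [HasInjectiveResolutions C]

/-- An object `X` is right `F`-acyclic if `R^q F (X) = 0` for all `q > 0`. -/
def IsRightAcyclic (F : C ⥤ D) [F.Additive] (X : C) : Prop :=
  ∀ q : ℕ, 0 < q → IsZero ((F.rightDerived q).obj X)

/-- An additive endofunctor `F` is weakly stable if `F(I)` is right `F`-acyclic for every
injective object `I`. -/
def IsWeaklyStableFunctor (F : C ⥤ C) [F.Additive] : Prop :=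
  ∀ I : C, Injective I → IsRightAcyclic F (F.obj I)

end Derived

section TorsionClasses

variable (A : Type u) [Ring A]

/-- A (hereditary) torsion class in the category of left `A`-modules: a class of modules closed
under submodules, quotients, extensions and arbitrary direct sums. -/
structure TorsionClass where
  /-- the class of modules -/
  mem : ObjectProperty (ModuleCat.{u} A)
  closedUnderSubobjects : mem.IsClosedUnderSubobjects
  closedUnderQuotients : mem.IsClosedUnderQuotients
  closedUnderExtensions : mem.IsClosedUnderExtensions
  directSum_mem : ∀ (X : Type u) (M : X → ModuleCat.{u} A), (∀ x, mem (M x)) →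
    mem (ModuleCat.of A (⨁ x, M x))

variable {A}

namespace TorsionClass

variable (T : TorsionClass A)

/-- The torsion submodule `Γ_T(M)`: the largest submodule of `M` that belongs to `T`. -/
def torsion (M : ModuleCat.{u} A) : Submodule A M :=
  sSup {N : Submodule A M | T.mem (ModuleCat.of A N)}

lemma map_torsion_le {M N : ModuleCat.{u} A} (f : M ⟶ N) :
    (T.torsion M).map f.hom ≤ T.torsion N := by
  have := T.closedUnderQuotients
  rw [torsion, sSup_eq_iSup', Submodule.map_iSup]
  refine iSup_le fun P => le_sSup ?_
  have : Epi (ModuleCat.ofHom (f.hom.submoduleMap P.1)) :=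
    (ModuleCat.epi_iff_surjective _).2 (f.hom.submoduleMap_surjective P.1)
  exact T.mem.prop_of_epi (ModuleCat.ofHom (f.hom.submoduleMap P.1)) P.2

/-- The torsion functor `Γ_T`, acting on morphisms by restriction. -/
def functor : ModuleCat.{u} A ⥤ ModuleCat.{u} A where
  obj M := ModuleCat.of A (T.torsion M)
  map f := ModuleCat.ofHom (f.hom.restrict fun _ hx =>
    T.map_torsion_le f (Submodule.mem_map_of_mem hx))

instance : T.functor.Additive where

/-- A torsion class is weakly stable if its torsion functor is. -/
def IsWeaklyStable : Prop := IsWeaklyStableFunctor T.functor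

end TorsionClass

end TorsionClasses

variable {A : Type u} [CommRing A]

section AdicTorsion

variable (𝔞 : Ideal A)

/-- The `𝔞`-torsion submodule `Γ_𝔞(M) = colim_i Hom(A / 𝔞 ^ i, M)`, i.e. the union over `i` of the
submodules of elements annihilated by `𝔞 ^ i`. -/
def adicTorsion (M : Type u) [AddCommGroup M] [Module A M] : Submodule A M :=
  ⨆ i : ℕ, Submodule.torsionBySet A M ((𝔞 ^ i : Ideal A) : Set A)

lemma mem_adicTorsion {M : Type u} [AddCommGroup M] [Module A M] (m : M) :
    m ∈ adicTorsion 𝔞 M ↔ ∃ i : ℕ, ∀ x ∈ 𝔞 ^ i, x • m = 0 := by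
  rw [adicTorsion, Submodule.mem_iSup_of_directed]
  · simp only [Submodule.mem_torsionBySet_iff, Subtype.forall, SetLike.mem_coe]
  · refine Monotone.directed_le fun i j hij => ?_
    exact Submodule.torsionBySet_le_torsionBySet_of_subset (Ideal.pow_le_pow_right hij)

/-- The class of `𝔞`-torsion modules: those `M` with `Γ_𝔞(M) = M`. -/
def adicTorsionModules : ObjectProperty (ModuleCat.{u} A) :=
  fun M => adicTorsion 𝔞 M = ⊤

lemma adicTorsionModules_iff (M : ModuleCat.{u} A) :
    adicTorsionModules 𝔞 M ↔ ∀ m : M, ∃ i : ℕ, ∀ x ∈ 𝔞 ^ i, x • m = 0 := by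
  rw [adicTorsionModules, Submodule.eq_top_iff']
  simp only [mem_adicTorsion]

/-- For a finitely generated ideal `𝔞`, the `𝔞`-torsion modules form a torsion class `T_𝔞`. -/
def adicTorsionClass (h𝔞 : 𝔞.FG) : TorsionClass A where
  mem := adicTorsionModules 𝔞
  closedUnderSubobjects := ⟨fun {X Y} f _ hY => by
    rw [adicTorsionModules_iff] at hY ⊢
    intro m
    obtain ⟨i, hi⟩ := hY (f.hom m)
    refine ⟨i, fun x hx => (ModuleCat.mono_iff_injective f).1 inferInstance ?_⟩
    rw [map_smul, map_zero]
    exact hi x hx⟩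
  closedUnderQuotients := ⟨fun {X Y} f _ hX => by
    rw [adicTorsionModules_iff] at hX ⊢
    intro m
    obtain ⟨m, rfl⟩ := (ModuleCat.epi_iff_surjective f).1 inferInstance m
    obtain ⟨i, hi⟩ := hX m
    refine ⟨i, fun x hx => ?_⟩
    rw [← map_smul, hi x hx, map_zero]⟩
  closedUnderExtensions := ⟨fun {S} hS h₁ h₃ => by
    rw [adicTorsionModules_iff] at h₁ h₃ ⊢
    intro m
    obtain ⟨i, hi⟩ := h₃ (S.g.hom m)
    obtain ⟨s, hs⟩ := h𝔞.pow (n := i)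
    have key : ∀ x ∈ 𝔞 ^ i, ∃ j : ℕ, ∀ y ∈ 𝔞 ^ j, y • (x • m) = 0 := by
      intro x hx
      have hx0 : S.g.hom (x • m) = 0 := by rw [map_smul]; exact hi x hx
      obtain ⟨n, hn⟩ := (ShortComplex.moduleCat_exact_iff S).1 hS.exact (x • m) hx0
      obtain ⟨j, hj⟩ := h₁ n
      refine ⟨j, fun y hy => ?_⟩
      rw [← hn]
      exact (map_smul S.f.hom y n).symm.trans ((congrArg S.f.hom (hj y hy)).trans (map_zero _))
    choose! j hj using key
    refine ⟨s.sup j + i, fun z hz => ?_⟩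
    rw [pow_add] at hz
    refine Submodule.mul_induction_on hz (fun y hy x hx => ?_) (fun x y hx hy => ?_)
    · rw [mul_smul]
      rw [← hs] at hx
      refine Submodule.span_induction (fun x hx => ?_) (by simp) (fun a b _ _ ha hb => ?_)
        (fun a b _ hb => ?_) hx
      · have hx' : x ∈ 𝔞 ^ i := hs ▸ Submodule.subset_span hx
        exact hj x hx' y (Ideal.pow_le_pow_right (Finset.le_sup hx) hy)
      · rw [add_smul, smul_add, ha, hb, add_zero]
      · rw [smul_eq_mul, mul_smul, smul_comm, hb, smul_zero]
    · rw [add_smul, hx, hy, add_zero]⟩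
  directSum_mem X M hM := by
    classical
    rw [adicTorsionModules_iff]
    simp only [adicTorsionModules_iff] at hM
    change ∀ m : ⨁ x, M x, _
    intro m
    induction m using DirectSum.induction_on with
    | zero => exact ⟨0, fun x _ => smul_zero x⟩
    | of k m =>
      obtain ⟨i, hi⟩ := hM k m
      refine ⟨i, fun x hx => ?_⟩
      change x • DirectSum.lof A X (fun x => M x) k m = 0
      rw [← map_smul, hi x hx, map_zero]
    | add a b ha hb =>
      obtain ⟨i, hi⟩ := ha
      obtain ⟨j, hj⟩ := hb
      refine ⟨max i j, fun x hx => ?_⟩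
      have h1 := hi x (Ideal.pow_le_pow_right (le_max_left i j) hx)
      have h2 := hj x (Ideal.pow_le_pow_right (le_max_right i j) hx)
      change x • a = 0 at h1
      change x • b = 0 at h2
      change x • (a + b) = 0
      rw [smul_add, h1, h2, add_zero]

end AdicTorsion

section Koszul

variable {n : ℕ}

/-- The Koszul differential `⋀^(p+1) Aⁿ → ⋀^p Aⁿ` of the sequence `a`,
`v₀ ∧ ⋯ ∧ v_p ↦ ∑ k, (-1)^k φ(v_k) v₀ ∧ ⋯ ∧ v̂_k ∧ ⋯ ∧ v_p`, where `φ : Aⁿ → A` is the linear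
form with `φ(e_k) = a_k`. -/
def koszulD (a : Fin n → A) (p : ℕ) :
    (⋀[A]^(p + 1) (Fin n → A)) →ₗ[A] (⋀[A]^p (Fin n → A)) :=
  exteriorPower.alternatingMapLinearEquiv (AlternatingMap.alternatizeUncurryFin
    ((Fintype.linearCombination A a).smulRight (exteriorPower.ιMulti A p)))

lemma koszulD_ιMulti (a : Fin n → A) (p : ℕ) (v : Fin (p + 1) → Fin n → A) :
    koszulD a p (exteriorPower.ιMulti A (p + 1) v) =
      ∑ k : Fin (p + 1), (-1) ^ (k : ℕ) •
        (Fintype.linearCombination A a (v k) • exteriorPower.ιMulti A p (k.removeNth v)) := by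
  simp [koszulD, AlternatingMap.alternatizeUncurryFin_apply]

lemma koszulD_comp (a : Fin n → A) (p : ℕ) : koszulD a p ∘ₗ koszulD a (p + 1) = 0 := by
  let φ := Fintype.linearCombination A a
  have h := AlternatingMap.alternatizeUncurryFin_alternatizeUncurryFinLM_comp_of_symmetric
    (f := φ.smulRight (φ.smulRight (exteriorPower.ιMulti A p)))
    (fun x y => by ext v; simp [smul_smul, mul_comm])
  apply exteriorPower.linearMap_ext
  ext v
  have h' := DFunLike.congr_fun h v
  simp only [AlternatingMap.alternatizeUncurryFin_apply, LinearMap.comp_apply,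
    AlternatingMap.alternatizeUncurryFinLM_apply, LinearMap.smulRight_apply] at h'
  simp only [LinearMap.compAlternatingMap_apply, LinearMap.comp_apply, koszulD_ιMulti, map_sum,
    map_zsmul, map_smul]
  refine congrArg Subtype.val (Eq.trans (Finset.sum_congr rfl fun x _ => ?_) h')
  rw [Finset.smul_sum]
  congr 1
  exact Finset.sum_congr rfl fun k _ => smul_comm _ _ _

/-- The Koszul complex `K(A; a)` of the sequence `a = (a₁, …, aₙ)`, graded homologically: the module
in degree `p`, `⋀^p Aⁿ`, is the one in cohomological degree `-p`. -/
abbrev koszulComplex (a : Fin n → A) : ChainComplex (ModuleCat.{u} A) ℕ :=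
  ChainComplex.of (fun p => ModuleCat.of A (⋀[A]^p (Fin n → A)))
    (fun p => ModuleCat.ofHom (koszulD a p))
    (fun p => by rw [← ModuleCat.ofHom_comp, koszulD_comp]; rfl)

lemma koszulComplex_d (a : Fin n → A) (p : ℕ) :
    (koszulComplex a).d (p + 1) p = ModuleCat.ofHom (koszulD a p) :=
  ChainComplex.of_d (fun p => ModuleCat.of A (⋀[A]^p (Fin n → A)))
    (fun p => ModuleCat.ofHom (koszulD a p)) p

lemma koszulD_comp_map (b c : Fin n → A) (p : ℕ) :
    koszulD b p ∘ₗ exteriorPower.map (p + 1) (LinearMap.mulLeft A c) =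
      exteriorPower.map p (LinearMap.mulLeft A c) ∘ₗ koszulD (b * c) p := by
  apply exteriorPower.linearMap_ext
  ext v
  have e : ∀ k : Fin (p + 1), (Fintype.linearCombination A b) (c * v k) =
      (Fintype.linearCombination A (b * c)) (v k) := fun k => by
    simp only [Fintype.linearCombination_apply, Pi.mul_apply, smul_eq_mul]
    exact Finset.sum_congr rfl fun _ _ => by ring
  simp only [LinearMap.compAlternatingMap_apply, LinearMap.comp_apply, koszulD_ιMulti,
    exteriorPower.map_apply_ιMulti, map_sum, map_zsmul, map_smul, Function.comp_apply,
    LinearMap.mulLeft_apply, e]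
  rfl

/-- The morphism of Koszul complexes `K(A; b c) → K(A; b)` given by the exterior powers of the map
`Aⁿ → Aⁿ`, `e_k ↦ c_k e_k`. Thus it is the identity in degree `0`, multiplication by the sequence
`c` in degree `1`, and it is compatible with exterior products. -/
def koszulMap (b c d : Fin n → A) (h : d = b * c) : koszulComplex d ⟶ koszulComplex b :=
  ChainComplex.ofHom (X := koszulComplex d) (Y := koszulComplex b)
    (fun p => ModuleCat.ofHom (exteriorPower.map p (LinearMap.mulLeft A c)))
    (fun p => by
      subst h
      rw [koszulComplex_d, koszulComplex_d]
      exact congrArg ModuleCat.ofHom (koszulD_comp_map b c p))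

/-- The inverse system of Koszul complexes `{K(A; a^i)}_{i ≥ 1}`, where `a^i = (a₁^i, …, aₙ^i)`; for
`i ≤ j` the transition `K(A; a^j) → K(A; a^i)` is multiplication by `a^(j-i)` in degree `1`. -/
def koszulSystem (a : Fin n → A) : ℕ+ᵒᵖ ⥤ ChainComplex (ModuleCat.{u} A) ℕ where
  obj i := koszulComplex (a ^ (i.unop : ℕ))
  map {j i} f := koszulMap (a ^ (i.unop : ℕ)) (a ^ ((j.unop : ℕ) - (i.unop : ℕ)))
    (a ^ (j.unop : ℕ)) (by
      have h : (i.unop : ℕ) ≤ j.unop := leOfHom f.unop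
      rw [← pow_add, Nat.add_sub_cancel' h])
  map_id i := by
    ext p : 1
    have h : LinearMap.mulLeft A (a ^ ((i.unop : ℕ) - (i.unop : ℕ))) = LinearMap.id := by
      ext; simp
    exact congrArg ModuleCat.ofHom
      ((congrArg (exteriorPower.map p) h).trans exteriorPower.map_id)
  map_comp {k j i} f g := by
    have h₁ : (j.unop : ℕ) ≤ k.unop := leOfHom f.unop
    have h₂ : (i.unop : ℕ) ≤ j.unop := leOfHom g.unop
    ext p : 1
    have h : LinearMap.mulLeft A (a ^ ((k.unop : ℕ) - (i.unop : ℕ))) =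
        LinearMap.mulLeft A (a ^ ((j.unop : ℕ) - (i.unop : ℕ))) ∘ₗ
          LinearMap.mulLeft A (a ^ ((k.unop : ℕ) - (j.unop : ℕ))) := by
      rw [← LinearMap.mulLeft_mul, ← pow_add]
      congr 2
      omega
    exact congrArg ModuleCat.ofHom
      ((congrArg (exteriorPower.map p) h).trans (exteriorPower.map_comp _ _))

/-- An inverse system `{M_i}_{i ≥ 1}` is pro-zero if for every `i` there is `j ≥ i` such that the
transition morphism `M_j → M_i` is zero. -/
def IsProZero {C : Type*} [Category C] [HasZeroMorphisms C] (M : ℕ+ᵒᵖ ⥤ C) : Prop :=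
  ∀ i : ℕ+, ∃ (j : ℕ+) (h : i ≤ j), M.map (homOfLE h).op = 0

/-- The sequence `a` is weakly proregular if for every `p > 0` the inverse system of Koszul homology
modules `{H_p(K(A; a^i))}_{i ≥ 1}` is pro-zero; `H_p` is the cohomology in degree `-p`. -/
def IsWeaklyProregular (a : Fin n → A) : Prop :=
  ∀ p : ℕ, 0 < p →
    IsProZero (koszulSystem a ⋙ HomologicalComplex.homologyFunctor (ModuleCat.{u} A) _ p)

end Koszul

end TorsionTheory

end

/-! Write `C^k` for the colimit over `i` of `Hom(K_k(A; a^i), I)`. By injectivity of `I`, weak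
proregularity is equivalent to exactness of `C` in all positive degrees for every injective `I`:
test cocycles come from embedding the cokernels of Koszul differentials into injectives
(`isWeaklyProregular_iff_exact`). Since `R^q Γ_𝔞(X) = colim_i Ext^q(A/𝔞^i, X)`
(`isZero_rightDerived_iff`), call `X` local if this colimit vanishes for all `q ≥ 0`. In positive
degrees `C^k` is local (`isAdicLocal_koszulColim`), and `C^0 = I`, with `ker d^0 = Γ_𝔞(I)`. From `0
→ Γ_𝔞(I) → I → im d^0 → 0`, the module `Γ_𝔞(I)` is acyclic if and only if `im d^0` is local
(`adicExtVanishes_torsion_iff`). Finally, `im d^0` is local if and only if `C` is exact in positive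
degrees (`isAdicLocal_range_iff_exact`). If `im d^k` is local, so is `C^(k+1) / im d^k`. It then has
no torsion, whereas the homology inside it is torsion and hence zero; locality passes to `im
d^(k+1)`. Conversely, a bounded exact complex of local modules has local images, by descent from the
top degree. -/

noncomputable section

namespace TorsionTheory

open CategoryTheory.Abelian

variable {A : Type u} [CommRing A]

/-! ### Modules with vanishing `colim_i Ext^q(A/𝔞^i, -)` -/

section AdicExt

variable (𝔞 : Ideal A)

/-- The projection `A / 𝔞 ^ j → A / 𝔞 ^ i` for `i ≤ j`. -/
def adicProj {i j : ℕ} (h : i ≤ j) :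
    ModuleCat.of A (A ⧸ 𝔞 ^ j) ⟶ ModuleCat.of A (A ⧸ 𝔞 ^ i) :=
  ModuleCat.ofHom (Submodule.factor (Ideal.pow_le_pow_right h))

lemma adicProj_comp {i j k : ℕ} (h : i ≤ j) (h' : j ≤ k) :
    adicProj 𝔞 h' ≫ adicProj 𝔞 h = adicProj 𝔞 (h.trans h') := by
  ext
  rfl

/-- The vanishing of `colim_i Ext^q(A / 𝔞 ^ i, X)`: every class becomes zero at a later stage. -/
def AdicExtVanishes (X : ModuleCat.{u} A) (q : ℕ) : Prop :=
  ∀ (i : ℕ) (e : Ext (ModuleCat.of A (A ⧸ 𝔞 ^ i)) X q),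
    ∃ (j : ℕ) (h : i ≤ j), (Ext.mk₀ (adicProj 𝔞 h)).comp e (zero_add q) = 0

variable {𝔞}

lemma adicProj_comp_ext {X : ModuleCat.{u} A} {q i j k : ℕ} (h : i ≤ j) (h' : j ≤ k)
    (e : Ext (ModuleCat.of A (A ⧸ 𝔞 ^ i)) X q) :
    (Ext.mk₀ (adicProj 𝔞 (h.trans h'))).comp e (zero_add q) =
      (Ext.mk₀ (adicProj 𝔞 h')).comp ((Ext.mk₀ (adicProj 𝔞 h)).comp e (zero_add q))
        (zero_add q) := by
  rw [← adicProj_comp, ← Ext.mk₀_comp_mk₀_assoc]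

namespace AdicExtVanishes

lemma of_injective (X : ModuleCat.{u} A) [Injective X] (q : ℕ) :
    AdicExtVanishes 𝔞 X (q + 1) := fun i e =>
  ⟨i, le_rfl, by rw [Ext.eq_zero_of_injective e, Ext.comp_zero]⟩

variable {S : ShortComplex (ModuleCat.{u} A)}

/-- A piece of the long exact sequence in the colimit. A first passage to a later stage kills the
connecting class, so that the class lifts to `X₂`; a second one kills the lift. -/
lemma right (hS : S.ShortExact) {q : ℕ} (h₂ : AdicExtVanishes 𝔞 S.X₂ q)
    (h₁ : AdicExtVanishes 𝔞 S.X₁ (q + 1)) : AdicExtVanishes 𝔞 S.X₃ q := by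
  intro i e
  obtain ⟨j, hij, hj⟩ := h₁ i (e.comp hS.extClass rfl)
  rw [← Ext.comp_assoc _ _ _ (zero_add q) rfl (by omega)] at hj
  obtain ⟨y, hy⟩ := Ext.covariant_sequence_exact₃ _ hS _ rfl hj
  obtain ⟨k, hjk, hk⟩ := h₂ j y
  refine ⟨k, hij.trans hjk, ?_⟩
  rw [adicProj_comp_ext hij hjk, ← hy, ← Ext.comp_assoc _ _ _ (zero_add q) (add_zero q) (by omega),
    hk, Ext.zero_comp]

lemma left (hS : S.ShortExact) {q : ℕ} (h₃ : AdicExtVanishes 𝔞 S.X₃ q)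
    (h₂ : AdicExtVanishes 𝔞 S.X₂ (q + 1)) : AdicExtVanishes 𝔞 S.X₁ (q + 1) := by
  intro i e
  obtain ⟨j, hij, hj⟩ := h₂ i (e.comp (Ext.mk₀ S.f) (add_zero _))
  rw [← Ext.comp_assoc _ _ _ (zero_add _) (add_zero _) (by omega)] at hj
  obtain ⟨y, hy⟩ := Ext.covariant_sequence_exact₁ _ hS _ hj rfl
  obtain ⟨k, hjk, hk⟩ := h₃ j y
  refine ⟨k, hij.trans hjk, ?_⟩
  rw [adicProj_comp_ext hij hjk, ← hy, ← Ext.comp_assoc _ _ _ (zero_add q) rfl (by omega),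
    hk, Ext.zero_comp]

lemma left_zero (hS : S.ShortExact) (h₂ : AdicExtVanishes 𝔞 S.X₂ 0) : AdicExtVanishes 𝔞 S.X₁ 0 := by
  intro i e
  obtain ⟨j, hij, hj⟩ := h₂ i (e.comp (Ext.mk₀ S.f) (add_zero _))
  rw [← Ext.comp_assoc _ _ _ (zero_add _) (add_zero _) (by omega)] at hj
  have := hS.mono_f
  exact ⟨j, hij, Ext.postcomp_mk₀_injective_of_mono _ S.f (hj.trans (map_zero _).symm)⟩

end AdicExtVanishes

variable (𝔞) in
/-- The vanishing of `colim_i Ext^q(A / 𝔞 ^ i, M)` for all `q`. -/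
def IsAdicLocal (M : Type u) [AddCommGroup M] [Module A M] : Prop :=
  ∀ q, AdicExtVanishes 𝔞 (ModuleCat.of A M) q

section Modules

variable {M N P : Type u} [AddCommGroup M] [Module A M] [AddCommGroup N] [Module A N]
  [AddCommGroup P] [Module A P]

lemma shortExact_of_linearMap {f : M →ₗ[A] N} {g : N →ₗ[A] P} (hf : Function.Injective f)
    (hg : Function.Surjective g) (hfg : Function.Exact f g) :
    (ShortComplex.mk (ModuleCat.ofHom f) (ModuleCat.ofHom g)
      (by rw [← ModuleCat.ofHom_comp, hfg.linearMap_comp_eq_zero]; rfl)).ShortExact where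
  exact := (ShortComplex.moduleCat_exact_iff _).2 fun x hx => (hfg x).1 hx
  mono_f := (ModuleCat.mono_iff_injective _).2 hf
  epi_g := (ModuleCat.epi_iff_surjective _).2 hg

/-- The morphism `A / 𝔞 ^ i → M` with `1 ↦ m`, for `m` annihilated by `𝔞 ^ i`. -/
def adicLift {M : ModuleCat.{u} A} {i : ℕ} (m : M) (hm : ∀ x ∈ 𝔞 ^ i, x • m = 0) :
    ModuleCat.of A (A ⧸ 𝔞 ^ i) ⟶ M :=
  ModuleCat.ofHom (Submodule.liftQ (𝔞 ^ i) (LinearMap.toSpanSingleton A M m)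
    fun x hx => hm x hx)

lemma adicLift_mkQ_one {M : ModuleCat.{u} A} {i : ℕ} (m : M) (hm : ∀ x ∈ 𝔞 ^ i, x • m = 0) :
    (adicLift m hm).hom (Submodule.mkQ (𝔞 ^ i) 1) = m := by
  change (1 : A) • m = m
  rw [one_smul]

lemma adic_hom_ext {M : ModuleCat.{u} A} {i : ℕ} {f g : ModuleCat.of A (A ⧸ 𝔞 ^ i) ⟶ M}
    (h : f.hom (Submodule.mkQ (𝔞 ^ i) 1) = g.hom (Submodule.mkQ (𝔞 ^ i) 1)) : f = g := by
  ext : 1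
  refine Submodule.linearMap_qext _ (LinearMap.ext_ring h)

lemma smul_adic_hom {M : ModuleCat.{u} A} {i : ℕ} (f : ModuleCat.of A (A ⧸ 𝔞 ^ i) ⟶ M) (x : A)
    (hx : x ∈ 𝔞 ^ i) : x • f.hom (Submodule.mkQ (𝔞 ^ i) 1) = 0 := by
  rw [← map_smul f.hom, ← map_smul (Submodule.mkQ (𝔞 ^ i)), Submodule.mkQ_apply,
    (Submodule.Quotient.mk_eq_zero _).2 (by simpa using hx), map_zero]

namespace IsAdicLocal

lemma of_subsingleton [Subsingleton M] : IsAdicLocal 𝔞 M := fun q i e => by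
  have h : Ext.mk₀ (𝟙 (ModuleCat.of A M)) = 0 := by
    rw [(ModuleCat.isZero_of_subsingleton (ModuleCat.of A M)).eq_of_src (𝟙 _) 0, Ext.mk₀_zero]
  refine ⟨i, le_rfl, ?_⟩
  rw [← Ext.comp_mk₀_id e, h, Ext.comp_zero, Ext.comp_zero]

lemma right {f : M →ₗ[A] N} {g : N →ₗ[A] P} (hf : Function.Injective f)
    (hg : Function.Surjective g) (hfg : Function.Exact f g) (hM : IsAdicLocal 𝔞 M)
    (hN : IsAdicLocal 𝔞 N) : IsAdicLocal 𝔞 P := fun q =>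
  AdicExtVanishes.right (shortExact_of_linearMap hf hg hfg) (hN q) (hM (q + 1))

lemma left {f : M →ₗ[A] N} {g : N →ₗ[A] P} (hf : Function.Injective f)
    (hg : Function.Surjective g) (hfg : Function.Exact f g) (hN : IsAdicLocal 𝔞 N)
    (hP : IsAdicLocal 𝔞 P) : IsAdicLocal 𝔞 M
  | 0 => AdicExtVanishes.left_zero (shortExact_of_linearMap hf hg hfg) (hN 0)
  | q + 1 => AdicExtVanishes.left (shortExact_of_linearMap hf hg hfg) (hP q) (hN (q + 1))

/-- On `Ext(A/𝔞^i, M)` the map `φ` acts as zero, because `𝔞^i` annihilates the first argument, and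
also as an automorphism. Hence the group is zero already at stage `i`. -/
lemma of_bijective (h : ∀ i : ℕ, ∃ φ ∈ 𝔞 ^ i • (⊤ : Submodule A (M →ₗ[A] M)),
    Function.Bijective φ) : IsAdicLocal 𝔞 M := by
  intro q i e
  refine ⟨i, le_rfl, ?_⟩
  suffices he : e = 0 by rw [he, Ext.comp_zero]
  obtain ⟨φ, hφ, hb⟩ := h i
  have key : ∀ e' : Ext (ModuleCat.of A (A ⧸ 𝔞 ^ i)) (ModuleCat.of A M) q,
      e'.comp (Ext.mk₀ (ModuleCat.ofHom φ)) (add_zero q) = 0 := by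
    refine Submodule.smul_induction_on hφ (fun r hr ψ _ e' => ?_) (fun ψ ψ' h h' e' => ?_)
    · have hr0 : r • 𝟙 (ModuleCat.of A (A ⧸ 𝔞 ^ i)) = 0 := by
        refine adic_hom_ext ?_
        change r • (Submodule.mkQ (𝔞 ^ i) 1) = 0
        rw [← map_smul, Submodule.mkQ_apply, Submodule.Quotient.mk_eq_zero, smul_eq_mul, mul_one]
        exact hr
      have h0 : r • e' = 0 := by
        rw [← Ext.mk₀_id_comp e', ← Ext.smul_comp, ← Ext.mk₀_smul, hr0, Ext.mk₀_zero,
          Ext.zero_comp]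
      rw [show ModuleCat.ofHom (r • ψ) = r • ModuleCat.ofHom ψ from rfl, Ext.mk₀_smul, Ext.comp_smul, ← Ext.smul_comp, h0, Ext.zero_comp]
    · rw [ModuleCat.ofHom_add, Ext.mk₀_add, Ext.comp_add, h, h', add_zero]
  let φ' := LinearEquiv.ofBijective φ hb
  have hc : ModuleCat.ofHom φ'.symm.toLinearMap ≫ ModuleCat.ofHom φ = 𝟙 (ModuleCat.of A M) := by
    ext x
    exact φ'.apply_symm_apply x
  rw [← Ext.comp_mk₀_id e, ← hc, ← Ext.mk₀_comp_mk₀,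
    ← Ext.comp_assoc _ _ _ (add_zero q) (add_zero 0) (by omega), key]

end IsAdicLocal

lemma AdicExtVanishes.eq_zero {X : ModuleCat.{u} A} (h : AdicExtVanishes 𝔞 X 0) {i : ℕ} (m : X)
    (hm : ∀ x ∈ 𝔞 ^ i, x • m = 0) : m = 0 := by
  obtain ⟨j, hij, hj⟩ := h i (Ext.mk₀ (adicLift m hm))
  rw [Ext.mk₀_comp_mk₀, ← Ext.mk₀_zero] at hj
  have h0 := (Ext.mk₀_bijective _ _).1 hj
  rw [← adicLift_mkQ_one m hm]
  exact congrArg (fun f => f.hom (Submodule.mkQ (𝔞 ^ j) 1)) h0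

end Modules

end AdicExt

/-! ### Derived functors of the torsion functor as colimits of `Ext` -/

section Derived

variable {𝔞 : Ideal A} (h𝔞 : 𝔞.FG)

lemma mem_torsion_adicTorsionClass {M : ModuleCat.{u} A} (m : M) :
    m ∈ (adicTorsionClass 𝔞 h𝔞).torsion M ↔ ∃ i : ℕ, ∀ x ∈ 𝔞 ^ i, x • m = 0 := by
  have key : (adicTorsionClass 𝔞 h𝔞).torsion M = adicTorsion 𝔞 M := by
    refine le_antisymm (sSup_le fun N hN n hn => ?_) (le_sSup ?_)
    · obtain ⟨i, hi⟩ := (adicTorsionModules_iff 𝔞 _).1 hN ⟨n, hn⟩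
      exact (mem_adicTorsion 𝔞 n).2 ⟨i, fun x hx => congrArg Subtype.val (hi x hx)⟩
    · refine (adicTorsionModules_iff 𝔞 _).2 fun n => ?_
      obtain ⟨i, hi⟩ := (mem_adicTorsion 𝔞 n.1).1 n.2
      exact ⟨i, fun x hx => Subtype.ext (hi x hx)⟩
  rw [key, mem_adicTorsion]

/-- For an injective resolution `J`, torsion elements of `J^q` are the same as morphisms `A/𝔞^i →
J^q` for some `i`. So cocycles and coboundaries of `Γ(J)` match those that compute `Ext`, after
enlarging `i`. -/
lemma isZero_rightDerived_iff (X : ModuleCat.{u} A) (q : ℕ) :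
    IsZero (((adicTorsionClass 𝔞 h𝔞).functor.rightDerived (q + 1)).obj X) ↔
      AdicExtVanishes 𝔞 X (q + 1) := by
  let J := injectiveResolution X
  rw [(J.isoRightDerivedObj _ (q + 1)).isZero_iff]
  change IsZero (HomologicalComplex.homology _ (q + 1)) ↔ _
  rw [← HomologicalComplex.exactAt_iff_isZero_homology,
    HomologicalComplex.exactAt_iff' _ q (q + 1) (q + 2) (by simp) (by simp),
    ShortComplex.moduleCat_exact_iff]
  constructor
  · intro H i e
    obtain ⟨f, hf, rfl⟩ := J.extMk_surjective e (q + 2) rfl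
    obtain ⟨⟨y, hy⟩, hy'⟩ := H ⟨f.hom (Submodule.mkQ (𝔞 ^ i) 1),
      (mem_torsion_adicTorsionClass h𝔞 _).2 ⟨i, smul_adic_hom f⟩⟩
      (Subtype.ext (congrArg (fun f => f.hom (Submodule.mkQ (𝔞 ^ i) 1)) hf))
    obtain ⟨m, hm⟩ := (mem_torsion_adicTorsionClass h𝔞 _).1 hy
    -- The primitive `y` is torsion, but the power of `𝔞` that kills it may be higher than `i`.
    refine ⟨max i m, le_max_left _ _, ?_⟩
    rw [J.mk₀_comp_extMk, J.extMk_eq_zero_iff _ _ _ _ q rfl]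
    refine ⟨adicLift y fun x hx => hm x (Ideal.pow_le_pow_right (le_max_right i m) hx),
      adic_hom_ext ?_⟩
    refine (congrArg (J.cocomplex.d q (q + 1)).hom (adicLift_mkQ_one y _)).trans ?_
    exact congrArg Subtype.val hy'
  · rintro H ⟨x, hx⟩ hx'
    obtain ⟨i, hi⟩ := (mem_torsion_adicTorsionClass h𝔞 _).1 hx
    have hd : adicLift x hi ≫ J.cocomplex.d (q + 1) (q + 2) = 0 :=
      adic_hom_ext ((congrArg (J.cocomplex.d (q + 1) (q + 2)).hom (adicLift_mkQ_one x hi)).trans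
        (congrArg Subtype.val hx'))
    obtain ⟨j, hij, hj⟩ := H i (J.extMk (adicLift x hi) (q + 2) rfl hd)
    rw [J.mk₀_comp_extMk, J.extMk_eq_zero_iff _ _ _ _ q rfl] at hj
    obtain ⟨g, hg⟩ := hj
    refine ⟨⟨g.hom (Submodule.mkQ (𝔞 ^ j) 1),
      (mem_torsion_adicTorsionClass h𝔞 _).2 ⟨j, smul_adic_hom g⟩⟩, Subtype.ext ?_⟩
    exact (congrArg (fun f => f.hom (Submodule.mkQ (𝔞 ^ j) 1)) hg).trans (adicLift_mkQ_one x hi)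

end Derived

variable {n : ℕ}

/-! ### Diagonal endomorphisms of exterior powers -/

section Diagonal

/-- The endomorphism of `⋀^k Aⁿ` induced by `e_j ↦ c_j e_j`. -/
abbrev koszulDiag (c : Fin n → A) (k : ℕ) : (⋀[A]^k (Fin n → A)) →ₗ[A] (⋀[A]^k (Fin n → A)) :=
  exteriorPower.map k (LinearMap.mulLeft A c)

lemma koszulDiag_mul (b c : Fin n → A) (k : ℕ) :
    koszulDiag (b * c) k = koszulDiag b k ∘ₗ koszulDiag c k := by
  rw [koszulDiag, LinearMap.mulLeft_mul, exteriorPower.map_comp]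

lemma koszulDiag_one (k : ℕ) : koszulDiag (1 : Fin n → A) k = LinearMap.id := by
  rw [koszulDiag, show LinearMap.mulLeft A (1 : Fin n → A) = LinearMap.id by ext; simp,
    exteriorPower.map_id]

lemma koszulDiag_pow_add (a : Fin n → A) (i j k : ℕ) :
    koszulDiag (a ^ i) k ∘ₗ koszulDiag (a ^ j) k = koszulDiag (a ^ (i + j)) k := by
  rw [pow_add, koszulDiag_mul]

lemma koszulDiag_basis (c : Fin n → A) (k : ℕ) (s : Set.powersetCard (Fin n) k) :
    koszulDiag c k ((Pi.basisFun A (Fin n)).exteriorPower k s) =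
      (∏ j, c (Set.powersetCard.ofFinEmbEquiv.symm s j)) •
        (Pi.basisFun A (Fin n)).exteriorPower k s := by
  rw [exteriorPower.basis_apply, exteriorPower.ιMulti_family, exteriorPower.map_apply_ιMulti,
    ← AlternatingMap.map_smul_univ]
  congr 1
  funext j
  ext l
  by_cases h : l = Set.powersetCard.ofFinEmbEquiv.symm s j
  · subst h; simp
  · simp [h]

/-- The projection of `⋀^k Aⁿ` onto the span of a basis vector. -/
def koszulProj (A : Type u) [CommRing A] {n : ℕ} (k : ℕ) (s : Set.powersetCard (Fin n) k) :
    (⋀[A]^k (Fin n → A)) →ₗ[A] (⋀[A]^k (Fin n → A)) :=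
  (((Pi.basisFun A (Fin n)).exteriorPower k).coord s).smulRight
    ((Pi.basisFun A (Fin n)).exteriorPower k s)

lemma koszulDiag_comp_koszulProj (c : Fin n → A) (k : ℕ) (s : Set.powersetCard (Fin n) k) :
    koszulDiag c k ∘ₗ koszulProj A k s = koszulProj A k s ∘ₗ koszulDiag c k := by
  refine ((Pi.basisFun A (Fin n)).exteriorPower k).ext fun t => ?_
  simp only [koszulProj, LinearMap.comp_apply, LinearMap.smulRight_apply, map_smul,
    koszulDiag_basis, Module.Basis.coord_apply, Module.Basis.repr_self]
  by_cases h : s = t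
  · subst h
    simp
  · simp [Finsupp.single_eq_of_ne h]

lemma koszulDiag_eq_sum (c : Fin n → A) (k : ℕ) :
    koszulDiag c k = ∑ s : Set.powersetCard (Fin n) k,
      (∏ j, c (Set.powersetCard.ofFinEmbEquiv.symm s j)) • koszulProj A k s := by
  refine ((Pi.basisFun A (Fin n)).exteriorPower k).ext fun t => ?_
  rw [koszulDiag_basis, LinearMap.sum_apply, Finset.sum_eq_single t]
  · simp [koszulProj]
  · intro s _ h
    rw [LinearMap.smul_apply, koszulProj, LinearMap.smulRight_apply, Module.Basis.coord_apply,
      Module.Basis.repr_self, Finsupp.single_eq_of_ne h, zero_smul, smul_zero]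
  · simp

instance subsingleton_exteriorPower (k : ℕ) :
    Subsingleton (⋀[A]^(n + k + 1) (Fin n → A)) := by
  have : IsEmpty (Set.powersetCard (Fin n) (n + k + 1)) := by
    refine ⟨fun s => ?_⟩
    have h := Finset.card_le_univ s.1
    rw [Set.powersetCard.card_eq, Fintype.card_fin] at h
    omega
  exact ((Pi.basisFun A (Fin n)).exteriorPower (n + k + 1)).repr.injective.subsingleton

end Diagonal

/-! ### Wedging with a vector as a homotopy -/

section Homotopy

/-- Left multiplication by `v` on exterior powers. -/
def wedgeLeft (v : Fin n → A) (k : ℕ) :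
    (⋀[A]^k (Fin n → A)) →ₗ[A] (⋀[A]^(k + 1) (Fin n → A)) :=
  exteriorPower.alternatingMapLinearEquiv ((exteriorPower.ιMulti A (k + 1)).curryLeft v)

lemma wedgeLeft_ιMulti (v : Fin n → A) (k : ℕ) (w : Fin k → Fin n → A) :
    wedgeLeft v k (exteriorPower.ιMulti A k w) =
      exteriorPower.ιMulti A (k + 1) (Fin.cons v w) := by
  simp [wedgeLeft]
  rfl

/-- The Koszul differential is an antiderivation, so `v ∧ -` is a homotopy from multiplication by
`φ(v)` to zero. With `v = e_j` it shows that the `j`-th member of the sequence kills homology. -/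
lemma koszulD_wedgeLeft (a v : Fin n → A) (k : ℕ) (z : ⋀[A]^(k + 1) (Fin n → A)) :
    koszulD a (k + 1) (wedgeLeft v (k + 1) z) =
      Fintype.linearCombination A a v • z - wedgeLeft v k (koszulD a k z) := by
  suffices h : koszulD a (k + 1) ∘ₗ wedgeLeft v (k + 1) =
      Fintype.linearCombination A a v • LinearMap.id - wedgeLeft v k ∘ₗ koszulD a k from
    LinearMap.congr_fun h z
  apply exteriorPower.linearMap_ext
  ext1 w
  simp only [LinearMap.compAlternatingMap_apply, LinearMap.comp_apply, wedgeLeft_ιMulti,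
    koszulD_ιMulti, LinearMap.sub_apply, LinearMap.smul_apply, LinearMap.id_apply, map_sum,
    map_zsmul, map_smul]
  rw [Fin.sum_univ_succ, sub_eq_add_neg, ← Finset.sum_neg_distrib]
  congr 1
  · simp
  · refine Finset.sum_congr rfl fun j _ => ?_
    rw [Fin.val_succ, pow_succ, mul_neg_one, neg_smul, Fin.cons_succ]
    congr 4
    funext l
    refine Fin.cases ?_ (fun l => ?_) l
    · simp [Fin.removeNth]
    · simp [Fin.removeNth]

end Homotopy

/-! ### The infinite dual Koszul complex -/

section Colimit

variable (a : Fin n → A) (X : Type u) [AddCommGroup X] [Module A X]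

/-- The transition map `Hom(⋀^k Aⁿ, X) → Hom(⋀^k Aⁿ, X)` from stage `i` to stage `j`. -/
def koszulTransition (k i j : ℕ) (_ : i ≤ j) :
    ((⋀[A]^k (Fin n → A)) →ₗ[A] X) →ₗ[A] ((⋀[A]^k (Fin n → A)) →ₗ[A] X) :=
  LinearMap.lcomp A X (koszulDiag (a ^ (j - i)) k)

lemma koszulTransition_apply (k i j : ℕ) (h : i ≤ j) (f : (⋀[A]^k (Fin n → A)) →ₗ[A] X) :
    koszulTransition a X k i j h f = f ∘ₗ koszulDiag (a ^ (j - i)) k := rfl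

instance (k : ℕ) : DirectedSystem (fun _ : ℕ => (⋀[A]^k (Fin n → A)) →ₗ[A] X)
    fun i j h => koszulTransition a X k i j h where
  map_self i f := by
    rw [koszulTransition_apply, Nat.sub_self, pow_zero, koszulDiag_one, LinearMap.comp_id]
  map_map {i j l} hij hjl f := by
    simp only [koszulTransition_apply]
    rw [LinearMap.comp_assoc, koszulDiag_pow_add]
    congr 3
    omega

/-- The colimit over `i` of `Hom(K_k(A; a ^ i), X)`: the term in degree `k` of the infinite dual
Koszul complex of `X`. -/
abbrev KoszulColim (k : ℕ) : Type u :=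
  Module.DirectLimit (fun _ : ℕ => (⋀[A]^k (Fin n → A)) →ₗ[A] X) (koszulTransition a X k)

/-- The class of a linear form on `K_k(A; a ^ i)`. -/
abbrev koszulClass (k i : ℕ) : ((⋀[A]^k (Fin n → A)) →ₗ[A] X) →ₗ[A] KoszulColim a X k :=
  Module.DirectLimit.of A ℕ (fun _ : ℕ => (⋀[A]^k (Fin n → A)) →ₗ[A] X) (koszulTransition a X k) i

variable {a X}

lemma koszulClass_comp_diag {k i m : ℕ} (f : (⋀[A]^k (Fin n → A)) →ₗ[A] X) :
    koszulClass a X k (i + m) (f ∘ₗ koszulDiag (a ^ m) k) = koszulClass a X k i f := by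
  have h := Module.DirectLimit.of_f (R := A) (f := koszulTransition a X k) (hij := i.le_add_right m)
    (x := f)
  rwa [koszulTransition_apply, Nat.add_sub_cancel_left] at h

lemma koszulClass_eq_zero_iff {k i : ℕ} (f : (⋀[A]^k (Fin n → A)) →ₗ[A] X) :
    koszulClass a X k i f = 0 ↔ ∃ m, f ∘ₗ koszulDiag (a ^ m) k = 0 := by
  constructor
  · intro h
    obtain ⟨j, hij, hj⟩ := Module.DirectLimit.of.zero_exact h
    exact ⟨j - i, hj⟩
  · rintro ⟨m, hm⟩
    rw [← koszulClass_comp_diag (m := m), hm, map_zero]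

/-- The colimit includes the stage `0`, which the Koszul system omits; moving one stage on makes the
index positive. -/
lemma exists_koszulClass {k : ℕ} (z : KoszulColim a X k) :
    ∃ i f, 0 < i ∧ koszulClass a X k i f = z := by
  obtain ⟨i, f, rfl⟩ := Module.DirectLimit.exists_of z
  exact ⟨i + 1, _, i.succ_pos, koszulClass_comp_diag f⟩

lemma koszulD_comp_diag (k i m : ℕ) :
    koszulD (a ^ i) k ∘ₗ koszulDiag (a ^ m) (k + 1) =
      koszulDiag (a ^ m) k ∘ₗ koszulD (a ^ (i + m)) k := by
  rw [pow_add, koszulD_comp_map]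

variable (a X) in
/-- The differential of the infinite dual Koszul complex. -/
def koszulColimD (k : ℕ) : KoszulColim a X k →ₗ[A] KoszulColim a X (k + 1) :=
  Module.DirectLimit.map (fun i => LinearMap.lcomp A X (koszulD (a ^ i) k)) fun i j h => by
    ext1 f
    simp only [LinearMap.comp_apply, koszulTransition_apply, LinearMap.lcomp_apply']
    rw [LinearMap.comp_assoc, LinearMap.comp_assoc, koszulD_comp_diag, Nat.add_sub_cancel' h]

lemma koszulColimD_class {k i : ℕ} (f : (⋀[A]^k (Fin n → A)) →ₗ[A] X) :
    koszulColimD a X k (koszulClass a X k i f) =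
      koszulClass a X (k + 1) i (f ∘ₗ koszulD (a ^ i) k) :=
  Module.DirectLimit.map_apply_of _ _ _

lemma koszulColimD_koszulColimD {k : ℕ} (z : KoszulColim a X k) :
    koszulColimD a X (k + 1) (koszulColimD a X k z) = 0 := by
  obtain ⟨i, f, -, rfl⟩ := exists_koszulClass z
  rw [koszulColimD_class, koszulColimD_class, LinearMap.comp_assoc, koszulD_comp,
    LinearMap.comp_zero, map_zero]

lemma exists_cocycle {k : ℕ} (z : KoszulColim a X k) (hz : koszulColimD a X k z = 0) :
    ∃ i f, 0 < i ∧ koszulClass a X k i f = z ∧ f ∘ₗ koszulD (a ^ i) k = 0 := by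
  obtain ⟨i, f, hi, rfl⟩ := exists_koszulClass z
  rw [koszulColimD_class, koszulClass_eq_zero_iff] at hz
  obtain ⟨m, hm⟩ := hz
  rw [LinearMap.comp_assoc, koszulD_comp_diag, ← LinearMap.comp_assoc] at hm
  exact ⟨i + m, _, by omega, koszulClass_comp_diag f, hm⟩

lemma exists_pow_le_span_pow (a : Fin n → A) (i : ℕ) :
    ∃ N, Ideal.span (Set.range a) ^ N ≤ Ideal.span (Set.range (a ^ i)) := by
  refine Ideal.exists_pow_le_of_le_radical_of_fg ?_ (Submodule.fg_span (Set.finite_range a))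
  rw [Ideal.span_le]
  rintro _ ⟨j, rfl⟩
  exact ⟨i, Ideal.subset_span ⟨j, rfl⟩⟩

/-- The homology of the infinite dual Koszul complex is torsion. -/
lemma exists_pow_smul_mem_range {k : ℕ} (z : KoszulColim a X (k + 1))
    (hz : koszulColimD a X (k + 1) z = 0) :
    ∃ N, ∀ x ∈ Ideal.span (Set.range a) ^ N, x • z ∈ LinearMap.range (koszulColimD a X k) := by
  obtain ⟨i, f, -, rfl, hf⟩ := exists_cocycle z hz
  obtain ⟨N, hN⟩ := exists_pow_le_span_pow a i
  refine ⟨N, fun x hx => ?_⟩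
  refine Submodule.span_induction ?_ (by simp) (fun x y _ _ hx hy => ?_) (fun r x _ hx => ?_)
    (hN hx)
  · rintro _ ⟨j, rfl⟩
    -- As `f` kills boundaries, the homotopy formula gives `f(e_j ∧ dw) = a_j^i f(w)`.
    refine ⟨koszulClass a X k i (f ∘ₗ wedgeLeft (Pi.single j 1) k), ?_⟩
    rw [koszulColimD_class, ← map_smul]
    congr 1
    refine LinearMap.ext fun w => ?_
    have h := congrArg f (koszulD_wedgeLeft (a ^ i) (Pi.single j 1) k w)
    rw [← LinearMap.comp_apply, hf, LinearMap.zero_apply, map_sub, map_smul, eq_comm,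
      sub_eq_zero] at h
    simpa using h.symm
  · rw [add_smul]
    exact add_mem hx hy
  · rw [smul_eq_mul, mul_smul]
    exact Submodule.smul_mem _ r hx

/-- The endomorphism of the colimit induced by a compatible endomorphism of `⋀^k Aⁿ`. -/
def koszulColimMap (k : ℕ) (ψ : (⋀[A]^k (Fin n → A)) →ₗ[A] (⋀[A]^k (Fin n → A)))
    (hψ : ∀ m, koszulDiag (a ^ m) k ∘ₗ ψ = ψ ∘ₗ koszulDiag (a ^ m) k) :
    KoszulColim a X k →ₗ[A] KoszulColim a X k :=
  Module.DirectLimit.map (fun _ => LinearMap.lcomp A X ψ) fun i j h => by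
    ext1 f
    simp only [LinearMap.comp_apply, koszulTransition_apply, LinearMap.lcomp_apply']
    rw [LinearMap.comp_assoc, LinearMap.comp_assoc, hψ]

lemma koszulColimMap_class {k i : ℕ} (ψ : (⋀[A]^k (Fin n → A)) →ₗ[A] (⋀[A]^k (Fin n → A)))
    (hψ : ∀ m, koszulDiag (a ^ m) k ∘ₗ ψ = ψ ∘ₗ koszulDiag (a ^ m) k)
    (f : (⋀[A]^k (Fin n → A)) →ₗ[A] X) :
    koszulColimMap k ψ hψ (koszulClass a X k i f) = koszulClass a X k i (f ∘ₗ ψ) :=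
  Module.DirectLimit.map_apply_of _ _ _

/-- Precomposition with the diagonal map of `a^i` is invertible in the colimit, its inverse being
the shift of the stage by `i`. In the standard basis its eigenvalues are products of `k + 1 ≥ 1`
factors `a_j^i`, so it lies in `𝔞^i • End`. This fails in degree `0`, where the product is empty. -/
lemma isAdicLocal_koszulColim (k : ℕ) :
    IsAdicLocal (Ideal.span (Set.range a)) (KoszulColim a X (k + 1)) := by
  refine IsAdicLocal.of_bijective fun i => ?_
  let φ : KoszulColim a X (k + 1) →ₗ[A] KoszulColim a X (k + 1) :=
    koszulColimMap (k + 1) (koszulDiag (a ^ i) (k + 1)) fun m => by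
      rw [koszulDiag_pow_add, koszulDiag_pow_add, add_comm m i]
  refine ⟨φ, ?_, ?_, ?_⟩
  · have hφ : φ = ∑ s : Set.powersetCard (Fin n) (k + 1),
        (∏ j, (a ^ i) (Set.powersetCard.ofFinEmbEquiv.symm s j)) •
          koszulColimMap (k + 1) (koszulProj A (k + 1) s)
            fun m => koszulDiag_comp_koszulProj (a ^ m) (k + 1) s := by
      refine LinearMap.ext fun z => ?_
      obtain ⟨l, f, -, rfl⟩ := exists_koszulClass z
      simp only [φ, koszulColimMap_class, LinearMap.sum_apply, LinearMap.smul_apply, ← map_smul,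
        ← map_sum]
      congr 1
      refine LinearMap.ext fun w => ?_
      rw [koszulDiag_eq_sum]
      simp
    rw [hφ]
    refine Submodule.sum_mem _ fun s _ => Submodule.smul_mem_smul ?_ Submodule.mem_top
    rw [Fin.prod_univ_succ]
    exact Ideal.mul_mem_right _ _ (Ideal.pow_mem_pow (Ideal.subset_span (Set.mem_range_self _)) i)
  · rw [injective_iff_map_eq_zero]
    intro z hz
    obtain ⟨l, f, -, rfl⟩ := exists_koszulClass z
    rw [koszulColimMap_class, koszulClass_eq_zero_iff] at hz
    obtain ⟨m, hm⟩ := hz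
    rw [LinearMap.comp_assoc, koszulDiag_pow_add] at hm
    exact (koszulClass_eq_zero_iff f).2 ⟨i + m, hm⟩
  · intro z
    obtain ⟨l, f, -, rfl⟩ := exists_koszulClass z
    exact ⟨koszulClass a X (k + 1) (l + i) f,
      (koszulColimMap_class _ _ _).trans (koszulClass_comp_diag f)⟩

instance subsingleton_koszulColim (k : ℕ) : Subsingleton (KoszulColim a X (n + k + 1)) := by
  refine subsingleton_of_forall_eq 0 fun z => ?_
  obtain ⟨l, f, -, rfl⟩ := exists_koszulClass z
  rw [Subsingleton.elim f 0, map_zero]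

end Colimit

/-! ### Degree zero: the module itself and its torsion -/

section Augmentation

variable (a : Fin n → A) (X : Type u) [AddCommGroup X] [Module A X]

lemma koszulDiag_zero (c : Fin n → A) : koszulDiag c 0 = LinearMap.id := by
  apply exteriorPower.linearMap_ext
  ext1 v
  simp only [LinearMap.compAlternatingMap_apply, exteriorPower.map_apply_ιMulti,
    LinearMap.id_apply]
  congr 1
  exact Subsingleton.elim _ _

/-- The isomorphism of `X` with the term in degree `0`, as a linear map. -/
def koszulAug : X →ₗ[A] KoszulColim a X 0 :=
  koszulClass a X 0 0 ∘ₗ LinearMap.lcomp A X (exteriorPower.zeroEquiv A (Fin n → A)).toLinearMap ∘ₗ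
    (LinearMap.ringLmapEquivSelf A A X).symm.toLinearMap

variable {a X}

lemma koszulAug_apply (x : X) : koszulAug a X x = koszulClass a X 0 0
    (LinearMap.toSpanSingleton A X x ∘ₗ (exteriorPower.zeroEquiv A (Fin n → A)).toLinearMap) :=
  rfl

lemma koszulAug_surjective : Function.Surjective (koszulAug a X) := by
  intro z
  obtain ⟨i, f, -, rfl⟩ := exists_koszulClass z
  refine ⟨f ((exteriorPower.zeroEquiv A (Fin n → A)).symm 1), ?_⟩
  rw [koszulAug_apply, ← koszulClass_comp_diag (m := i), koszulDiag_zero, zero_add]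
  congr 1
  refine LinearMap.ext fun w => ?_
  simp only [LinearMap.comp_id, LinearMap.comp_apply, LinearMap.toSpanSingleton_apply,
    LinearEquiv.coe_coe]
  rw [← map_smul, ← map_smul, smul_eq_mul, mul_one, LinearEquiv.symm_apply_apply]

/-- At stage `m` the differential of `x` has components `a_j^m x`, and the ideals generated by the
`a_j^m` are cofinal with the powers of `𝔞`. -/
lemma koszulColimD_koszulAug_eq_zero_iff (x : X) :
    koszulColimD a X 0 (koszulAug a X x) = 0 ↔
      ∃ m : ℕ, ∀ y ∈ Ideal.span (Set.range a) ^ m, y • x = 0 := by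
  have key (m : ℕ) : (LinearMap.toSpanSingleton A X x ∘ₗ
      (exteriorPower.zeroEquiv A (Fin n → A)).toLinearMap) ∘ₗ koszulD (a ^ m) 0 = 0 ↔
      ∀ j, a j ^ m • x = 0 := by
    have hv (v : Fin 1 → Fin n → A) : (LinearMap.toSpanSingleton A X x ∘ₗ
        (exteriorPower.zeroEquiv A (Fin n → A)).toLinearMap) (koszulD (a ^ m) 0
          (exteriorPower.ιMulti A 1 v)) = Fintype.linearCombination A (a ^ m) (v 0) • x := by
      rw [koszulD_ιMulti]
      simp
    constructor
    · intro h j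
      have h1 := hv fun _ => Pi.single j 1
      rw [← LinearMap.comp_apply, h] at h1
      simpa using h1.symm
    · intro h
      apply exteriorPower.linearMap_ext
      ext1 v
      refine (hv v).trans ?_
      simp [Fintype.linearCombination_apply, Finset.sum_smul, mul_smul, h]
  rw [koszulAug_apply, koszulColimD_class, koszulClass_eq_zero_iff]
  simp only [LinearMap.comp_assoc, koszulD_comp_diag]
  simp only [koszulDiag_zero, LinearMap.id_comp, zero_add]
  simp only [← LinearMap.comp_assoc, key]
  constructor
  · rintro ⟨m, hm⟩
    obtain ⟨N, hN⟩ := exists_pow_le_span_pow a m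
    refine ⟨N, fun y hy => ?_⟩
    refine Submodule.span_induction ?_ (by simp) (fun y z _ _ hy hz => ?_) (fun r y _ hy => ?_)
      (hN hy)
    · rintro _ ⟨j, rfl⟩
      exact hm j
    · rw [add_smul, hy, hz, add_zero]
    · rw [smul_eq_mul, mul_smul, hy, smul_zero]
  · rintro ⟨m, hm⟩
    exact ⟨m, fun j => hm _ (Ideal.pow_mem_pow (Ideal.subset_span (Set.mem_range_self j)) m)⟩

end Augmentation

/-! ### Weak proregularity tested on injective modules -/

lemma homologyMap_eq_zero_iff {K L : ChainComplex (ModuleCat.{u} A) ℕ} (φ : K ⟶ L) (p : ℕ) :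
    HomologicalComplex.homologyMap φ (p + 1) = 0 ↔
      ∀ z : K.X (p + 1), (K.d (p + 1) p).hom z = 0 →
        ∃ w : L.X (p + 2), (L.d (p + 2) (p + 1)).hom w = (φ.f (p + 1)).hom z := by
  have hex := (ShortComplex.moduleCat_exact_iff _).1 (ShortComplex.exact_of_g_is_cokernel
    (ShortComplex.mk _ _ (L.toCycles_comp_homologyπ (p + 2) (p + 1)))
    (L.homologyIsCokernel (p + 2) (p + 1) (by simp)))
  have hi : Function.Injective (L.iCycles (p + 1)).hom :=
    (ModuleCat.mono_iff_injective _).1 inferInstance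
  rw [← cancel_epi (K.homologyπ (p + 1)), comp_zero, HomologicalComplex.homologyπ_naturality]
  constructor
  · intro h z hz
    let c := K.cyclesMk z p (by simp) hz
    have hc : (K.iCycles (p + 1)).hom c = z := K.i_cyclesMk z p (by simp) hz
    obtain ⟨w, hw⟩ := hex ((HomologicalComplex.cyclesMap φ (p + 1)).hom c)
      (congrArg (fun f => f.hom c) h)
    refine ⟨w, ?_⟩
    rw [← hc]
    refine (congrArg (fun f => f.hom w) (L.toCycles_i (p + 2) (p + 1))).symm.trans ?_
    refine (congrArg (L.iCycles (p + 1)).hom hw).trans ?_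
    exact congrArg (fun f => f.hom c) (HomologicalComplex.cyclesMap_i φ (p + 1))
  · intro h
    ext c
    obtain ⟨w, hw⟩ := h ((K.iCycles (p + 1)).hom c)
      (congrArg (fun f => f.hom c) (K.iCycles_d (p + 1) p))
    have hw' : (L.toCycles (p + 2) (p + 1)).hom w =
        (HomologicalComplex.cyclesMap φ (p + 1)).hom c := by
      apply hi
      refine (congrArg (fun f => f.hom w) (L.toCycles_i (p + 2) (p + 1))).trans (hw.trans ?_)
      exact (congrArg (fun f => f.hom c) (HomologicalComplex.cyclesMap_i φ (p + 1))).symm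
    refine (congrArg (L.homologyπ (p + 1)).hom hw').symm.trans ?_
    exact congrArg (fun f => f.hom w) (L.toCycles_comp_homologyπ (p + 2) (p + 1))

lemma isWeaklyProregular_iff (a : Fin n → A) :
    IsWeaklyProregular a ↔ ∀ p i : ℕ, 0 < i → ∃ m, ∀ z : ⋀[A]^(p + 1) (Fin n → A),
      koszulD (a ^ (i + m)) p z = 0 →
        koszulDiag (a ^ m) (p + 1) z ∈ LinearMap.range (koszulD (a ^ i) (p + 1)) := by
  have key (p : ℕ) (i j : ℕ+) (h : i ≤ j) : (koszulSystem a ⋙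
      HomologicalComplex.homologyFunctor (ModuleCat.{u} A) _ (p + 1)).map (homOfLE h).op = 0 ↔
      ∀ z : ⋀[A]^(p + 1) (Fin n → A), koszulD (a ^ (j : ℕ)) p z = 0 →
        koszulDiag (a ^ ((j : ℕ) - i)) (p + 1) z ∈
          LinearMap.range (koszulD (a ^ (i : ℕ)) (p + 1)) := by
    have hd := koszulComplex_d (a ^ (j : ℕ)) p
    have hd' := koszulComplex_d (a ^ (i : ℕ)) (p + 1)
    refine (homologyMap_eq_zero_iff ((koszulSystem a).map (homOfLE h).op) p).trans ?_
    change (∀ z : ⋀[A]^(p + 1) (Fin n → A),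
      ((koszulComplex (a ^ (j : ℕ))).d (p + 1) p).hom z = 0 →
      ∃ w : ⋀[A]^(p + 2) (Fin n → A), ((koszulComplex (a ^ (i : ℕ))).d (p + 2) (p + 1)).hom w =
        koszulDiag (a ^ ((j : ℕ) - i)) (p + 1) z) ↔ _
    rw [hd, hd']
    rfl
  constructor
  · intro h p i hi
    obtain ⟨j, hij, hj⟩ := h (p + 1) p.succ_pos ⟨i, hi⟩
    have hij' : i ≤ j := hij
    refine ⟨j - i, ?_⟩
    rw [Nat.add_sub_cancel' hij']
    exact (key p _ _ hij).1 hj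
  · intro h p hp i
    obtain ⟨p, rfl⟩ := Nat.exists_eq_add_of_le' hp
    obtain ⟨m, hm⟩ := h p i i.pos
    have hij : i ≤ ⟨i + m, by have := i.pos; omega⟩ := PNat.coe_le_coe _ _ |>.1 (by simp)
    refine ⟨_, hij, (key p _ _ hij).2 ?_⟩
    simpa using hm

/-- Both maps descend to `M / ker f`, which embeds in `N`. -/
lemma exists_extension {M N I : Type u} [AddCommGroup M] [Module A M] [AddCommGroup N]
    [Module A N] [AddCommGroup I] [Module A I] [Injective (ModuleCat.of A I)] (f : M →ₗ[A] N)
    (g : M →ₗ[A] I) (h : ∀ x, f x = 0 → g x = 0) : ∃ k : N →ₗ[A] I, k ∘ₗ f = g := by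
  let f' : M ⧸ LinearMap.ker f →ₗ[A] N := (LinearMap.ker f).liftQ f le_rfl
  let g' : M ⧸ LinearMap.ker f →ₗ[A] I := (LinearMap.ker f).liftQ g fun x hx => h x hx
  have : Mono (ModuleCat.ofHom f') := (ModuleCat.mono_iff_injective _).2
    (LinearMap.ker_eq_bot.1 (Submodule.ker_liftQ_eq_bot _ _ _ le_rfl))
  refine ⟨(Injective.factorThru (ModuleCat.ofHom g') (ModuleCat.ofHom f')).hom, ?_⟩
  refine LinearMap.ext fun x => ?_
  exact congrArg (fun k => k.hom ((LinearMap.ker f).mkQ x))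
    (Injective.comp_factorThru (ModuleCat.ofHom g') (ModuleCat.ofHom f'))

/-- A sequence is weakly proregular if and only if the infinite dual Koszul complex of every
injective module is exact in positive degrees. -/
lemma isWeaklyProregular_iff_exact (a : Fin n → A) :
    IsWeaklyProregular a ↔ ∀ I : ModuleCat.{u} A, Injective I → ∀ k (z : KoszulColim a I (k + 1)),
      koszulColimD a I (k + 1) z = 0 → z ∈ LinearMap.range (koszulColimD a I k) := by
  rw [isWeaklyProregular_iff]
  constructor
  · intro h I hI k z hz
    obtain ⟨i, f, hi, rfl, hf⟩ := exists_cocycle z hz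
    obtain ⟨m, hm⟩ := h k i hi
    have : Injective (ModuleCat.of A I) := hI
    -- The transition map sends cycles to boundaries, where the cocycle `f` vanishes; so the
    -- transported `f` factors through the differential and is a coboundary.
    obtain ⟨g, hg⟩ := exists_extension (koszulD (a ^ (i + m)) k)
      (f ∘ₗ koszulDiag (a ^ m) (k + 1)) fun w hw => by
        obtain ⟨v, hv⟩ := hm w hw
        rw [LinearMap.comp_apply, ← hv]
        exact LinearMap.congr_fun hf v
    exact ⟨koszulClass a I k (i + m) g, by rw [koszulColimD_class, hg, koszulClass_comp_diag]⟩
  · intro h p i _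
    -- The universal test cocycle: embedding the cokernel of the differential in an injective gives
    -- a form `f` whose kernel is exactly the boundaries.
    let Q : ModuleCat.{u} A := ModuleCat.of A
      ((⋀[A]^(p + 1) (Fin n → A)) ⧸ LinearMap.range (koszulD (a ^ i) (p + 1)))
    let f : (⋀[A]^(p + 1) (Fin n → A)) →ₗ[A] (Injective.under Q : ModuleCat.{u} A) :=
      (Injective.ι Q).hom ∘ₗ (LinearMap.range (koszulD (a ^ i) (p + 1))).mkQ
    have hι : Function.Injective (Injective.ι Q).hom :=
      (ModuleCat.mono_iff_injective _).1 inferInstance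
    have hf0 (w) : f w = 0 ↔ w ∈ LinearMap.range (koszulD (a ^ i) (p + 1)) := by
      rw [← Submodule.Quotient.mk_eq_zero, LinearMap.comp_apply, map_eq_zero_iff _ hι]
      rfl
    have hf : f ∘ₗ koszulD (a ^ i) (p + 1) = 0 :=
      LinearMap.ext fun w => (hf0 _).2 ⟨w, rfl⟩
    obtain ⟨y, hy⟩ := h (Injective.under Q) inferInstance p
      (koszulClass a _ (p + 1) i f) (by rw [koszulColimD_class, hf, map_zero])
    obtain ⟨j, g, -, rfl⟩ := exists_koszulClass y
    rw [koszulColimD_class, ← koszulClass_comp_diag (i := i) (m := j),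
      ← koszulClass_comp_diag (i := j) (m := i), add_comm j i, ← sub_eq_zero, ← map_sub,
      koszulClass_eq_zero_iff] at hy
    obtain ⟨m, hm⟩ := hy
    -- Here `j` is the stage of the primitive `g`, and `m` the further shift after which `f` and the
    -- coboundary of `g`, compared at stage `i + j`, agree. On a cycle the coboundary vanishes,
    -- hence so does `f`.
    refine ⟨j + m, fun z hz => (hf0 _).1 ?_⟩
    rw [LinearMap.sub_comp, LinearMap.comp_assoc, LinearMap.comp_assoc, koszulDiag_pow_add,
      LinearMap.comp_assoc, koszulDiag_pow_add, koszulD_comp_diag, sub_eq_zero,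
      Nat.add_left_comm j i m] at hm
    have h1 := LinearMap.congr_fun hm z
    simp only [LinearMap.comp_apply, hz, map_zero] at h1
    exact h1.symm

/-! ### Locality of images and exactness -/

section

variable {a : Fin n → A} {X : Type u} [AddCommGroup X] [Module A X]

lemma koszulColim_exact_subtype {k : ℕ}
    (h : ∀ z, koszulColimD a X (k + 1) z = 0 → z ∈ LinearMap.range (koszulColimD a X k)) :
    Function.Exact (LinearMap.range (koszulColimD a X k)).subtype
      (koszulColimD a X (k + 1)).rangeRestrict := by
  intro z
  rw [← Submodule.coe_eq_zero, LinearMap.codRestrict_apply]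
  constructor
  · exact fun hz => ⟨⟨z, h z hz⟩, rfl⟩
  · rintro ⟨⟨_, y, rfl⟩, rfl⟩
    exact koszulColimD_koszulColimD y

/-- The quotient of `C^(k+1)` by a local image is local, hence without nonzero torsion, while
homology classes in it are torsion. -/
lemma koszulColim_exact_of_isAdicLocal_range {k : ℕ}
    (h : IsAdicLocal (Ideal.span (Set.range a)) (LinearMap.range (koszulColimD a X k)))
    (z : KoszulColim a X (k + 1)) (hz : koszulColimD a X (k + 1) z = 0) :
    z ∈ LinearMap.range (koszulColimD a X k) := by
  have hq := IsAdicLocal.right (LinearMap.range (koszulColimD a X k)).injective_subtype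
    (LinearMap.range (koszulColimD a X k)).mkQ_surjective
    (LinearMap.exact_subtype_mkQ _) h (isAdicLocal_koszulColim k)
  obtain ⟨N, hN⟩ := exists_pow_smul_mem_range z hz
  rw [← Submodule.Quotient.mk_eq_zero]
  refine (hq 0).eq_zero (i := N) (Submodule.Quotient.mk z) fun x hx => ?_
  exact (Submodule.Quotient.mk_eq_zero _).2 (hN x hx)

lemma isAdicLocal_range_iff_exact :
    IsAdicLocal (Ideal.span (Set.range a)) (LinearMap.range (koszulColimD a X 0)) ↔
      ∀ k (z : KoszulColim a X (k + 1)),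
        koszulColimD a X (k + 1) z = 0 → z ∈ LinearMap.range (koszulColimD a X k) := by
  constructor
  · intro h k
    have hk : IsAdicLocal (Ideal.span (Set.range a)) (LinearMap.range (koszulColimD a X k)) := by
      induction k with
      | zero => exact h
      | succ k ih =>
        exact IsAdicLocal.right (Submodule.injective_subtype _) (LinearMap.surjective_rangeRestrict _)
          (koszulColim_exact_subtype (koszulColim_exact_of_isAdicLocal_range ih)) ih
          (isAdicLocal_koszulColim k)
    exact koszulColim_exact_of_isAdicLocal_range hk
  · intro h
    have step (k : ℕ) (hk : IsAdicLocal (Ideal.span (Set.range a))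
        (LinearMap.range (koszulColimD a X (k + 1)))) :
        IsAdicLocal (Ideal.span (Set.range a)) (LinearMap.range (koszulColimD a X k)) :=
      IsAdicLocal.left (Submodule.injective_subtype _) (LinearMap.surjective_rangeRestrict _)
        (koszulColim_exact_subtype (h k)) (isAdicLocal_koszulColim k) hk
    -- The image of `d^n` lies in `C^(n+1)`, which is zero.
    have top : IsAdicLocal (Ideal.span (Set.range a)) (LinearMap.range (koszulColimD a X n)) :=
      have : Subsingleton (KoszulColim a X (n + 1)) := subsingleton_koszulColim 0
      IsAdicLocal.of_subsingleton
    exact Nat.decreasingInduction (fun k _ hk => step k hk) top n.zero_le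

end

/-! ### Acyclicity of the torsion of an injective -/

/-- Dimension shifting along `0 → Γ_𝔞(I) → I → im d^0 → 0`. Only degree `0` needs a separate
argument, as `Hom(A/𝔞^i, I)` need not vanish in the colimit. -/
lemma adicExtVanishes_torsion_iff (a : Fin n → A) (I : ModuleCat.{u} A) [Injective I] :
    (∀ q, AdicExtVanishes (Ideal.span (Set.range a))
      (ModuleCat.of A ((adicTorsionClass (Ideal.span (Set.range a))
        (Submodule.fg_span (Set.finite_range a))).torsion I)) (q + 1)) ↔
      IsAdicLocal (Ideal.span (Set.range a)) (LinearMap.range (koszulColimD a I 0)) := by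
  set T := adicTorsionClass (Ideal.span (Set.range a)) (Submodule.fg_span (Set.finite_range a))
  let g : I →ₗ[A] LinearMap.range (koszulColimD a I 0) :=
    (koszulColimD a I 0).rangeRestrict ∘ₗ koszulAug a I
  have hg0 (x : I) : g x = 0 ↔ ∃ m : ℕ, ∀ y ∈ Ideal.span (Set.range a) ^ m, y • x = 0 := by
    rw [← koszulColimD_koszulAug_eq_zero_iff, ← Submodule.coe_eq_zero]
    rfl
  have hg : Function.Surjective g :=
    (LinearMap.surjective_rangeRestrict _).comp koszulAug_surjective
  have hex : Function.Exact (T.torsion I).subtype g := fun x => by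
    rw [hg0, ← mem_torsion_adicTorsionClass (Submodule.fg_span (Set.finite_range a))]
    simp [T]
  have hS := shortExact_of_linearMap (M := T.torsion I) (N := I)
    (P := LinearMap.range (koszulColimD a I 0)) (f := (T.torsion I).subtype) (g := g)
    (T.torsion I).injective_subtype hg hex
  have hI (q : ℕ) : AdicExtVanishes (Ideal.span (Set.range a)) I (q + 1) :=
    AdicExtVanishes.of_injective I q
  constructor
  · rintro h (_ | q)
    · intro i e
      obtain ⟨j, hij, hj⟩ := h 0 i (e.comp hS.extClass rfl)
      rw [← Abelian.Ext.comp_assoc _ _ _ (zero_add 0) rfl (by omega)] at hj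
      obtain ⟨y, hy⟩ := Abelian.Ext.covariant_sequence_exact₃ _ hS _ rfl hj
      refine ⟨j, hij, ?_⟩
      obtain ⟨y, rfl⟩ := (Abelian.Ext.mk₀_bijective _ _).2 y
      rw [← hy, Abelian.Ext.mk₀_comp_mk₀]
      refine (congrArg Abelian.Ext.mk₀ (adic_hom_ext (g := 0) ?_)).trans
        (Abelian.Ext.mk₀_zero _ _)
      -- A morphism `A/𝔞^j → I` lands in `Γ_𝔞(I)`, which is the kernel of `g`.
      exact (hg0 _).2 ⟨j, smul_adic_hom y⟩
    · exact AdicExtVanishes.right hS (hI q) (h (q + 1))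
  · exact fun h q => AdicExtVanishes.left hS (h q) (hI q)

end TorsionTheory

end

theorem theorem47 {A : Type u} [CommRing A] {n : ℕ} (a : Fin n → A) :
    TorsionTheory.IsWeaklyProregular a ↔
      (TorsionTheory.adicTorsionClass (Ideal.span (Set.range a))
        (Submodule.fg_span (Set.finite_range a))).IsWeaklyStable := by
  rw [TorsionTheory.isWeaklyProregular_iff_exact]
  -- Once weak proregularity is tested on injectives, the equivalence holds for each `I` separately.
  refine forall₂_congr fun I hI => ?_
  rw [← TorsionTheory.isAdicLocal_range_iff_exact, ← TorsionTheory.adicExtVanishes_torsion_iff]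
  constructor
  · intro h q hq
    obtain ⟨q, rfl⟩ := Nat.exists_eq_add_of_le' hq
    exact (TorsionTheory.isZero_rightDerived_iff _ _ q).2 (h q)
  · exact fun h q => (TorsionTheory.isZero_rightDerived_iff _ _ q).1 (h (q + 1) q.succ_pos)
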